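/- Consider the $\mathsf{CONGEST}$ model: the $n$ nodes of an undirected graph $G$ with maximum degree $\Delta$ communicate in synchronous rounds, each node sending one message of $O(\log n)$ bits per round over each of its incident links. A node initially knows $n$, $\Delta$, its degree (its links are numbered locally), its own unique identifier from $\{0,\dots,n^{\kappa}-1\}$ for a constant $\kappa$, and private random bits independent of those of the other nodes; local computation is free. Let $|OPT|$ denote the maximum size of a matching of $G$. Theorem. For all constants $\varepsilon>0$ and $C>0$ there is a randomized algorithm in the $\mathsf{CONGEST}$ model that runs for $O\!\left(\frac{\log\Delta}{\log\log\Delta}\right)$ rounds ($O(1)$ rounds if $\Delta\le 2$) on every graph $G$, always outputs a matching $M$ of $G$ (each node outputs its link in $M$, or that it is unmatched), and satisfies $$|OPT|\le(2+\varepsilon)\,|M|\qquad\text{with probability at least }1-e^{-C|OPT|}.$$ In particular, the $(2+\varepsilon)$-approximation holds with probability at least $1-n^{-C}$ whenever $|OPT|\ge\ln n$. The constant in the round bound depends only on $\varepsilon$, $C$ and $\kappa$; the constant in the message size depends only on $\kappa$. -/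

import Mathlib

/-- A communication network on `n` nodes: a simple graph, an identifier for every node (distinct
nodes have distinct identifiers), and for every node a numbering `0, 1, …, deg v - 1` of its
incident links (its ports). The names `Fin n` of the nodes are not visible to the algorithms. -/
structure Network (n : ℕ) where
  graph : SimpleGraph (Fin n)
  id : Fin n → ℕ
  id_injective : Function.Injective id
  port : (v : Fin n) → graph.neighborSet v ≃ Fin (Nat.card (graph.neighborSet v))

namespace Network

variable {n : ℕ}

/-- The degree of a node. -/
noncomputable def degree (N : Network n) (v : Fin n) : ℕ :=
  Nat.card (N.graph.neighborSet v)

open scoped Classical in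
/-- The maximum degree `Δ` of the network. -/
noncomputable def maxDegree (N : Network n) : ℕ :=
  N.graph.maxDegree

/-- What node `v` receives on its port `p` when every node `u` puts the message `msg u q` on each
of its ports `q`. On numbers that are not ports of `v` nothing (the empty message) arrives. -/
noncomputable def inbox (N : Network n) (msg : Fin n → ℕ → List Bool) (v : Fin n) (p : ℕ) :
    List Bool :=
  if h : p < Nat.card (N.graph.neighborSet v) then
    let u : N.graph.neighborSet v := (N.port v).symm ⟨p, h⟩
    msg u (N.port u ⟨v, SimpleGraph.Adj.symm u.2⟩)
  else []

end Network

/-- A randomized synchronous message-passing algorithm; every node runs the same local program.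
At the start a node knows only the number `n` of nodes, the maximum degree `Δ`, its own identifier,
its own degree, and a private random seed, uniform in `{0, …, seedBound n Δ}`. In each round it
sends a bit string on each of its ports (depending on its state), then updates its state from the
bit strings received. After `rounds n Δ` rounds it outputs a port, or `none`.
Local memory and local computation are unrestricted. -/
structure DistributedAlgorithm where
  State : Type
  rounds : (n Δ : ℕ) → ℕ
  seedBound : (n Δ : ℕ) → ℕ
  init : (n Δ ident deg seed : ℕ) → State
  send : State → (p : ℕ) → List Bool
  receive : State → (inbox : ℕ → List Bool) → State
  output : State → Option ℕ

namespace DistributedAlgorithm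

variable {n : ℕ}

/-- The joint assignments of private seeds to the nodes. The uniform distribution on this finite
type is the law of independent uniform seeds. -/
abbrev Seeds (A : DistributedAlgorithm) (N : Network n) : Type :=
  Fin n → Fin (A.seedBound n N.maxDegree + 1)

/-- The state of every node after `t` rounds. -/
noncomputable def stateAt (A : DistributedAlgorithm) (N : Network n) (r : A.Seeds N) :
    ℕ → Fin n → A.State
  | 0, v => A.init n N.maxDegree (N.id v) (N.degree v) (r v)
  | t + 1, v =>
      A.receive (stateAt A N r t v) (N.inbox (fun u q => A.send (stateAt A N r t u) q) v)

/-- No message sent over a link during the execution is longer than `b` bits. -/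
def MessagesAtMost (A : DistributedAlgorithm) (N : Network n) (r : A.Seeds N) (b : ℕ) : Prop :=
  ∀ t < A.rounds n N.maxDegree, ∀ (v : Fin n), ∀ p < N.degree v,
    (A.send (A.stateAt N r t v) p).length ≤ b

/-- The output of node `v` at the end of the execution. -/
noncomputable def outputAt (A : DistributedAlgorithm) (N : Network n) (r : A.Seeds N)
    (v : Fin n) : Option ℕ :=
  A.output (A.stateAt N r (A.rounds n N.maxDegree) v)

/-- The execution with seeds `r` computes the matching `M`: each node matched by `M` outputs its
port that leads to its partner, and every other node outputs `none`. -/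
def ComputesMatching (A : DistributedAlgorithm) (N : Network n) (r : A.Seeds N)
    (M : N.graph.Subgraph) : Prop :=
  M.IsMatching ∧
    ∀ (v : Fin n) (p : ℕ), A.outputAt N r v = some p ↔
      ∃ u : N.graph.neighborSet v, M.Adj v u ∧ (N.port v u : ℕ) = p

/-- The probability of an event over the nodes' independent private seeds. -/
noncomputable def prob (A : DistributedAlgorithm) (N : Network n) (E : A.Seeds N → Prop) : ℝ :=
  (Nat.card {r : A.Seeds N // E r} : ℝ) / (Nat.card (A.Seeds N) : ℝ)

end DistributedAlgorithm

/-- The maximum number of edges of a matching in the finite graph `G`. -/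
noncomputable def matchingNumber {n : ℕ} (G : SimpleGraph (Fin n)) : ℕ :=
  sSup {k | ∃ M : G.Subgraph, M.IsMatching ∧ M.edgeSet.ncard = k}

/-- The supremum in the definition of `matchingNumber` is a maximum. -/
theorem matchingNumber_isGreatest {n : ℕ} (G : SimpleGraph (Fin n)) :
    IsGreatest {k | ∃ M : G.Subgraph, M.IsMatching ∧ M.edgeSet.ncard = k} (matchingNumber G) := by
  have hne : {k | ∃ M : G.Subgraph, M.IsMatching ∧ M.edgeSet.ncard = k}.Nonempty :=
    ⟨_, ⊥, fun v hv => hv.elim, rfl⟩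
  have hb : BddAbove {k | ∃ M : G.Subgraph, M.IsMatching ∧ M.edgeSet.ncard = k} := by
    refine ⟨Nat.card (Sym2 (Fin n)), ?_⟩
    rintro k ⟨M, -, rfl⟩
    exact Set.ncard_le_card _
  exact ⟨Nat.sSup_mem hne hb, fun k hk => le_csSup hb hk⟩

/-! The algorithm runs a constant number `J` of stages. A stage colours every node left or right by
a fair coin and then performs `T` iterations, in each of which every unmatched left node proposes to
a uniformly random unmatched right neighbour, and every right node that receives proposals accepts
one. The analysis asks how likely it is that all edges of a given set `F` of disjoint edges are
untouched, that is, have both endpoints unmatched.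

For one iteration with fixed colours, let `S` be a set of left nodes that all stay unmatched. A
right node that receives a proposal becomes matched, so whatever a node of `S` proposed to was also
proposed to from outside `S`. Fix the choices outside `S`; they determine the set `H` of right nodes
hit from outside. A node with candidate set `A`, of which a fraction `t` avoids `H`, picks in `H`
with probability `1 - t`, and afterwards has at most `t |A|` candidates. Weighting by `|A| ^ β`
gives the factor `(1 - t) * t ^ β ≤ lam`, independently for the nodes of `S`. Hence the expected
potential shrinks by `lam ^ |S|` per iteration (`sum_potential_step_le`). It starts at most at `Δ ^
(β |S|)` and is at least 1 if the nodes of `S` are unmatched with unmatched right neighbours, so `T`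
iterations make this event have probability at most `2 ^ (-|S|)`. With `β = 1 / log Δ`, a number `T`
of order `log Δ / log log Δ` suffices (`exists_goodParameters`).

Averaging over colours, where an edge has differently coloured ends with probability 1/2, shows that
`F` survives a stage with probability at most `(3/4) ^ |F|` (`sum_stage_le`). After `J` stages, a
union bound over the large subsets of a maximum matching (`card_many_untouched_le`) leaves few
untouched edges except with probability `exp (-C |OPT|)`. Every other edge has a matched endpoint,
and the output has two matched nodes per edge; this is the factor 2. -/

/-! ### Iterated random maps and averages of products. -/

/-- The state reached from `s` after reading the first inputs of the sequence `ω`. -/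
def runSteps {S X : Type*} (f : S → X → S) (s : S) (ω : ℕ → X) : ℕ → S
  | 0 => s
  | k + 1 => f (runSteps f s ω k) (ω k)

/-- A finite sequence, continued by a default value. -/
def extendSeq {X : Type*} [Inhabited X] {k : ℕ} (ω : Fin k → X) (t : ℕ) : X :=
  if h : t < k then ω ⟨t, h⟩ else default

theorem runSteps_congr {S X : Type*} (f : S → X → S) (s : S) {ω ω' : ℕ → X} {k : ℕ}
    (h : ∀ t < k, ω t = ω' t) : runSteps f s ω k = runSteps f s ω' k := by
  induction k with
  | zero => rfl
  | succ k ih =>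
    simp only [runSteps]
    rw [ih fun t ht => h t (by omega), h k (by omega)]

theorem runSteps_add {S X : Type*} (f : S → X → S) (s : S) (ω : ℕ → X) (a b : ℕ) :
    runSteps f s ω (a + b) = runSteps f (runSteps f s ω a) (fun t => ω (a + t)) b := by
  induction b with
  | zero => rfl
  | succ b ih => rw [← add_assoc]; simp only [runSteps]; rw [ih]

/-- Splitting off the last input and averaging over it alone applies the one-step bound to the state
reached before; this plays the role of conditional expectation. -/
theorem sum_runSteps_le {S X : Type*} [Fintype X] [Inhabited X] (f : S → X → S) (Φ : S → ℝ)
    {ρ : ℝ} (hρ : 0 ≤ ρ) (h : ∀ s, ∑ x, Φ (f s x) ≤ ρ * Fintype.card X * Φ s) (s : S) (k : ℕ) :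
    ∑ ω : Fin k → X, Φ (runSteps f s (extendSeq ω) k) ≤
      ρ ^ k * (Fintype.card X : ℝ) ^ k * Φ s := by
  induction k with
  | zero => simp [runSteps]
  | succ k ih =>
    rw [← (Fin.snocEquiv fun _ : Fin (k + 1) => X).sum_comp, Fintype.sum_prod_type,
      Finset.sum_comm]
    have key : ∀ (x : X) (ω : Fin k → X),
        runSteps f s (extendSeq (Fin.snocEquiv (fun _ : Fin (k + 1) => X) (x, ω))) (k + 1) =
          f (runSteps f s (extendSeq ω) k) x := by
      intro x ω
      simp only [runSteps]
      congr 1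
      · apply runSteps_congr
        intro t ht
        simp [extendSeq, ht, Nat.lt_succ_of_lt ht, Fin.snocEquiv, Fin.snoc]
      · simp [extendSeq, Fin.snocEquiv, Fin.snoc]
    simp only [key]
    calc _ ≤ ∑ ω : Fin k → X, ρ * Fintype.card X * Φ (runSteps f s (extendSeq ω) k) :=
          Finset.sum_le_sum fun ω _ => h _
      _ = ρ * Fintype.card X * ∑ ω : Fin k → X, Φ (runSteps f s (extendSeq ω) k) := by
          rw [Finset.mul_sum]
      _ ≤ ρ * Fintype.card X * (ρ ^ k * (Fintype.card X : ℝ) ^ k * Φ s) := by gcongr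
      _ = _ := by ring

/-- Resampling the coordinates in `S` preserves the uniform law: exchanging these coordinates
between `x` and `z` is an involution on pairs. -/
theorem sum_sum_piecewise {V X : Type*} [Fintype V] [DecidableEq V] [Fintype X] (S : Finset V)
    (f : (V → X) → ℝ) :
    ∑ x : V → X, ∑ z : V → X, f (S.piecewise z x) = Fintype.card (V → X) * ∑ x, f x := by
  have e : Function.Involutive fun p : (V → X) × (V → X) =>
      (S.piecewise p.2 p.1, S.piecewise p.1 p.2) := by
    rintro ⟨x, z⟩
    ext v <;> by_cases hv : v ∈ S <;> simp [hv]
  calc _ = ∑ p : (V → X) × (V → X), f (S.piecewise p.2 p.1) := by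
        rw [Fintype.sum_prod_type]
    _ = ∑ p : (V → X) × (V → X), f p.1 := by
        rw [← Equiv.sum_comp (e.toPerm _) (fun p : (V → X) × (V → X) => f p.1)]
        rfl
    _ = _ := by
        rw [Fintype.sum_prod_type, Finset.sum_comm]
        simp

/-- Averages of a product of functions, each of which depends only on one coordinate in `S` and on
the coordinates outside `S`. -/
theorem sum_prod_le {V X : Type*} [Fintype V] [DecidableEq V] [Fintype X] (S : Finset V)
    (h : V → (V → X) → X → ℝ) (hdep : ∀ v ∈ S, ∀ x z, h v (S.piecewise z x) = h v x)
    (hpos : ∀ v x z, 0 ≤ h v x z) (b : V → ℝ)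
    (hb : ∀ v ∈ S, ∀ x, ∑ z, h v x z ≤ Fintype.card X * b v) :
    ∑ x : V → X, ∏ v ∈ S, h v x (x v) ≤ Fintype.card (V → X) * ∏ v ∈ S, b v := by
  classical
  rcases isEmpty_or_nonempty (V → X) with hE | hE
  · simp
  have hc : (0 : ℝ) < Fintype.card (V → X) := by exact_mod_cast Fintype.card_pos
  refine le_of_mul_le_mul_left ?_ hc
  rw [← sum_sum_piecewise S]
  -- With `x` fixed outside `S` and `z` supplying the coordinates in `S`, the factors depend on
  -- distinct coordinates of `z`, so the sum of the product factorizes.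
  have hx : ∀ x : V → X, ∑ z : V → X, ∏ v ∈ S, h v (S.piecewise z x) (S.piecewise z x v) ≤
      Fintype.card (V → X) * ∏ v ∈ S, b v := by
    intro x
    have h1 : ∀ z : V → X, ∏ v ∈ S, h v (S.piecewise z x) (S.piecewise z x v) =
        ∏ v, if v ∈ S then h v x (z v) else 1 := by
      intro z
      rw [← Finset.prod_filter, Finset.filter_univ_mem]
      refine Finset.prod_congr rfl fun v hv => ?_
      rw [hdep v hv, Finset.piecewise_eq_of_mem _ _ _ hv]
    simp only [h1]
    rw [← Fintype.piFinset_univ,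
      ← Finset.prod_univ_sum (fun _ : V => (Finset.univ : Finset X))
        (fun v z => if v ∈ S then h v x z else 1)]
    calc _ ≤ ∏ v : V, (Fintype.card X * if v ∈ S then b v else 1 : ℝ) := by
          refine Finset.prod_le_prod ?_ ?_
          · intro v _
            refine Finset.sum_nonneg fun z _ => ?_
            split_ifs
            · exact hpos _ _ _
            · exact zero_le_one
          · intro v _
            by_cases hv : v ∈ S
            · simpa [hv] using hb v hv x
            · simp [hv]
      _ = _ := by
          rw [Finset.prod_mul_distrib, ← Finset.prod_filter, Finset.filter_univ_mem]
          simp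
  calc _ ≤ ∑ x : V → X, (Fintype.card (V → X) * ∏ v ∈ S, b v : ℝ) :=
        Finset.sum_le_sum fun x _ => hx x
    _ = _ := by simp

/-! ### The proposal process on an abstract graph. -/

open Classical in
/-- The local decisions of the proposal process on `G`: a node `v` proposes to a member of a set of
neighbours that is uniformly distributed when the choice in `Y` is, and it accepts one member of a
set of neighbours that propose to it. -/
structure ProposalRule {V : Type*} (G : SimpleGraph V) (Y : Type*) [Fintype Y] where
  pick : V → Finset V → Y → V
  accept : V → Finset V → V
  pick_mem : ∀ v A y, (∀ u ∈ A, G.Adj v u) → A.Nonempty → pick v A y ∈ A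
  accept_mem : ∀ v A, (∀ u ∈ A, G.Adj v u) → A.Nonempty → accept v A ∈ A
  card_pick : ∀ v A, (∀ u ∈ A, G.Adj v u) → A.Nonempty → ∀ B ⊆ A,
    (Finset.univ.filter fun y => pick v A y ∈ B).card * A.card = Fintype.card Y * B.card

namespace ProposalRule

variable {V Y : Type*} [Fintype V] [Fintype Y] {G : SimpleGraph V} (R : ProposalRule G Y)

open Classical in
/-- The unmatched right (`false`) neighbours of `v` when `s` records the partners. -/
noncomputable def cand (G : SimpleGraph V) (c : V → Bool) (s : V → Option V) (v : V) : Finset V :=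
  Finset.univ.filter fun u => G.Adj v u ∧ s u = none ∧ c u = false

open Classical in
/-- The node to which `v` proposes. -/
noncomputable def proposal (c : V → Bool) (s : V → Option V) (x : V → Y) (v : V) : Option V :=
  if s v = none ∧ c v = true ∧ (cand G c s v).Nonempty then some (R.pick v (cand G c s v) (x v))
  else none

open Classical in
/-- The nodes that propose to `w`. -/
noncomputable def incoming (c : V → Bool) (s : V → Option V) (x : V → Y) (w : V) : Finset V :=
  Finset.univ.filter fun v => R.proposal c s x v = some w

open Classical in
/-- The node whose proposal `w` accepts. -/
noncomputable def accepted (c : V → Bool) (s : V → Option V) (x : V → Y) (w : V) : Option V :=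
  if (R.incoming c s x w).Nonempty then some (R.accept w (R.incoming c s x w)) else none

open Classical in
/-- The partners after one iteration. -/
noncomputable def step (c : V → Bool) (s : V → Option V) (x : V → Y) (v : V) : Option V :=
  (s v).or ((R.accepted c s x v).or
    ((R.proposal c s x v).filter fun w => R.accepted c s x w = some v))

/-- `s` records the partners in a matching of `G`. -/
def Consistent (G : SimpleGraph V) (s : V → Option V) : Prop :=
  ∀ v u, s v = some u → G.Adj v u ∧ s u = some v

variable {R} {c : V → Bool} {s : V → Option V} {x : V → Y} {u v w : V}

theorem mem_cand : u ∈ cand G c s v ↔ G.Adj v u ∧ s u = none ∧ c u = false := by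
  simp [cand]

theorem adj_of_mem_cand : ∀ u ∈ cand G c s v, G.Adj v u := fun _ h => (mem_cand.1 h).1

theorem of_proposal (h : R.proposal c s x v = some w) :
    s v = none ∧ c v = true ∧ w ∈ cand G c s v := by
  unfold proposal at h
  split_ifs at h with hc
  refine ⟨hc.1, hc.2.1, ?_⟩
  rw [← Option.some.inj h]
  exact R.pick_mem _ _ _ adj_of_mem_cand hc.2.2

theorem mem_incoming : v ∈ R.incoming c s x w ↔ R.proposal c s x v = some w := by
  simp [incoming]

theorem adj_of_mem_incoming : ∀ v ∈ R.incoming c s x w, G.Adj w v := fun _ h =>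
  (mem_cand.1 (of_proposal (mem_incoming.1 h)).2.2).1.symm

theorem of_accepted (h : R.accepted c s x w = some v) : R.proposal c s x v = some w := by
  unfold accepted at h
  split_ifs at h with hc
  rw [← mem_incoming, ← Option.some.inj h]
  exact R.accept_mem _ _ adj_of_mem_incoming hc

theorem exists_accepted (h : R.proposal c s x v = some w) : ∃ u, R.accepted c s x w = some u := by
  have : (R.incoming c s x w).Nonempty := ⟨v, mem_incoming.2 h⟩
  exact ⟨_, if_pos this⟩

theorem step_of_eq_some (h : s v = some u) : R.step c s x v = some u := by
  simp [step, h]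

theorem step_eq_some_iff : R.step c s x v = some u ↔ s v = some u ∨
    s v = none ∧ (R.accepted c s x v = some u ∨
      R.accepted c s x v = none ∧ R.proposal c s x v = some u ∧ R.accepted c s x u = some v) := by
  simp [step, Option.or_eq_some_iff, Option.filter_eq_some_iff]

/-- Colours keep the two roles apart: an accepted proposer is left, so it receives no proposals and
its own `accepted` cannot override its proposal. -/
theorem step_of_accepted (h : R.accepted c s x w = some v) :
    R.step c s x w = some v ∧ R.step c s x v = some w := by
  have hp := of_accepted h
  obtain ⟨hs, hcv, hw⟩ := of_proposal hp
  obtain ⟨-, hsw, hcw⟩ := mem_cand.1 hw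
  refine ⟨step_eq_some_iff.2 (.inr ⟨hsw, .inl h⟩), step_eq_some_iff.2 (.inr ⟨hs, .inr ⟨?_, hp, h⟩⟩)⟩
  by_contra hne
  obtain ⟨t, ht⟩ := Option.ne_none_iff_exists'.1 hne
  have := (mem_cand.1 (of_proposal (of_accepted ht)).2.2).2.2
  simp [hcv] at this

theorem Consistent.step (h : Consistent G s) : Consistent G (R.step c s x) := by
  intro v u hv
  rcases step_eq_some_iff.1 hv with hv | ⟨hs, hv | ⟨-, hp, hv⟩⟩
  · exact ⟨(h v u hv).1, step_of_eq_some (h v u hv).2⟩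
  · exact ⟨(adj_of_mem_cand _ (of_proposal (of_accepted hv)).2.2).symm, (step_of_accepted hv).2⟩
  · exact ⟨adj_of_mem_cand _ (of_proposal hp).2.2, (step_of_accepted hv).1⟩

theorem eq_none_of_step (h : R.step c s x v = none) : s v = none := by
  by_contra hne
  obtain ⟨t, ht⟩ := Option.ne_none_iff_exists'.1 hne
  simp [step_of_eq_some (R := R) (c := c) (x := x) ht] at h

theorem step_ne_none_of_proposal (h : R.proposal c s x v = some w) : R.step c s x w ≠ none := by
  obtain ⟨u, hu⟩ := exists_accepted h
  simp [(step_of_accepted hu).1]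

/-! ### Decrease of the potential in one iteration. -/

open Classical in
/-- The nodes to which the nodes outside `S` propose. -/
noncomputable def hit (R : ProposalRule G Y) (c : V → Bool) (s : V → Option V) (S : Finset V)
    (x : V → Y) : Finset V :=
  Finset.univ.filter fun w => ∃ v ∉ S, R.proposal c s x v = some w

theorem mem_hit {S : Finset V} : w ∈ R.hit c s S x ↔ ∃ v ∉ S, R.proposal c s x v = some w := by
  simp [hit]

theorem proposal_congr {x' : V → Y} (h : x v = x' v) :
    R.proposal c s x v = R.proposal c s x' v := by
  simp [proposal, h]

-- This is the source of conditional independence: the choices made in `S` do not influence the hit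
-- set.
open Classical in
theorem hit_piecewise (S : Finset V) (z x : V → Y) :
    R.hit c s S (S.piecewise z x) = R.hit c s S x := by
  ext w
  simp only [mem_hit]
  refine exists_congr fun v => and_congr_right fun hv => ?_
  rw [proposal_congr (Finset.piecewise_eq_of_notMem S z x hv)]

/-- The node `w` accepts some proposer, which thereby becomes matched and so cannot lie in `S`. -/
theorem hit_of_failure {S : Finset V} (hS : ∀ v ∈ S, R.step c s x v = none)
    (hp : R.proposal c s x v = some w) : w ∈ R.hit c s S x := by
  obtain ⟨u, hu⟩ := exists_accepted hp
  refine mem_hit.2 ⟨u, fun huS => ?_, of_accepted hu⟩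
  simpa [hS u huS] using (step_of_accepted hu).2

open Classical in
theorem cand_step_subset (S : Finset V) :
    cand G c (R.step c s x) v ⊆ cand G c s v \ R.hit c s S x := by
  intro w hw
  obtain ⟨ha, hs, hc⟩ := mem_cand.1 hw
  refine Finset.mem_sdiff.2 ⟨mem_cand.2 ⟨ha, eq_none_of_step hs, hc⟩, fun h => ?_⟩
  obtain ⟨v, -, hv⟩ := mem_hit.1 h
  exact step_ne_none_of_proposal hv hs

open Classical in
/-- The potential of a set `S` of left nodes; it is positive only if all of them are unmatched and
have unmatched right neighbours. -/
noncomputable def potential (G : SimpleGraph V) (c : V → Bool) (β : ℝ) (S : Finset V)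
    (s : V → Option V) : ℝ :=
  if ∀ v ∈ S, s v = none then ∏ v ∈ S, ((cand G c s v).card : ℝ) ^ β else 0

theorem potential_nonneg (β : ℝ) (S : Finset V) : 0 ≤ potential G c β S s := by
  unfold potential
  split_ifs
  · exact Finset.prod_nonneg fun v _ => Real.rpow_nonneg (Nat.cast_nonneg _) _
  · exact le_rfl

-- With `t = |A \ H| / |A|`, the pick falls in `H` with probability `1 - t`, and the weight is `t ^
-- β * |A| ^ β`.
omit [Fintype V] in
open Classical in
theorem sum_pick_le (R : ProposalRule G Y) {β lam : ℝ} (hβ : 0 < β)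
    (hlam : ∀ t : ℝ, 0 ≤ t → t ≤ 1 → (1 - t) * t ^ β ≤ lam) (v : V) (A H : Finset V)
    (hA : ∀ u ∈ A, G.Adj v u) :
    ∑ z, (if R.pick v A z ∈ A ∩ H then ((A \ H).card : ℝ) ^ β else 0) ≤
      Fintype.card Y * (lam * (A.card : ℝ) ^ β) := by
  rcases A.eq_empty_or_nonempty with rfl | hne
  · simp [Real.zero_rpow hβ.ne']
  have hpos : (0 : ℝ) < A.card := by exact_mod_cast hne.card_pos
  have h1 := R.card_pick v A hA hne (A ∩ H) Finset.inter_subset_left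
  have h2 : (A ∩ H).card + (A \ H).card = A.card := by
    rw [add_comm]; exact Finset.card_sdiff_add_card_inter A H
  rw [← Finset.sum_filter, Finset.sum_const, nsmul_eq_mul]
  have h1' : ((Finset.univ.filter fun y => R.pick v A y ∈ A ∩ H).card : ℝ) * A.card =
      Fintype.card Y * (A ∩ H).card := by exact_mod_cast h1
  have h2' : ((A ∩ H).card : ℝ) + (A \ H).card = A.card := by exact_mod_cast h2
  set a : ℝ := (A.card : ℝ)
  set t : ℝ := ((A \ H).card : ℝ)
  have ht : 0 ≤ t := Nat.cast_nonneg _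
  have ht1 : t ≤ a := by rw [← h2']; simp
  have h3 : ((Finset.univ.filter fun y => R.pick v A y ∈ A ∩ H).card : ℝ) =
      Fintype.card Y * (1 - t / a) := by
    field_simp
    rw [h1', ← h2']
    ring
  have h4 := hlam (t / a) (by positivity) ((div_le_one hpos).2 ht1)
  rw [Real.div_rpow ht hpos.le] at h4
  have h5 : (1 - t / a) * t ^ β ≤ lam * a ^ β := by
    have : 0 < a ^ β := Real.rpow_pos_of_pos hpos _
    rw [← mul_div_assoc, div_le_iff₀ this] at h4
    exact h4
  rw [h3, mul_assoc]
  gcongr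

open Classical in
theorem sum_potential_step_le (R : ProposalRule G Y) {β lam : ℝ} (hβ : 0 < β)
    (hlam : ∀ t : ℝ, 0 ≤ t → t ≤ 1 → (1 - t) * t ^ β ≤ lam) (S : Finset V)
    (hS : ∀ v ∈ S, c v = true) (s : V → Option V) :
    ∑ x, potential G c β S (R.step c s x) ≤
      lam ^ S.card * Fintype.card (V → Y) * potential G c β S s := by
  by_cases hs : ∀ v ∈ S, s v = none
  swap
  · have hz : ∀ x, potential G c β S (R.step c s x) = 0 := fun x =>
      if_neg fun h => hs fun v hv => eq_none_of_step (h v hv)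
    rw [Finset.sum_eq_zero fun x _ => hz x, potential, if_neg hs, mul_zero]
  let h : V → (V → Y) → Y → ℝ := fun v x z =>
    if R.pick v (cand G c s v) z ∈ cand G c s v ∩ R.hit c s S x then
      ((cand G c s v \ R.hit c s S x).card : ℝ) ^ β else 0
  have h0 : ∀ v x z, 0 ≤ h v x z := by
    intro v x z
    simp only [h]
    split_ifs
    · positivity
    · exact le_rfl
  have hle : ∀ x, potential G c β S (R.step c s x) ≤ ∏ v ∈ S, h v x (x v) := by
    intro x
    by_cases hf : ∀ v ∈ S, R.step c s x v = none
    swap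
    · rw [potential, if_neg hf]
      exact Finset.prod_nonneg fun v _ => h0 _ _ _
    rw [potential, if_pos hf]
    refine Finset.prod_le_prod (fun v _ => by positivity) fun v hv => ?_
    have hsub := Finset.card_le_card (cand_step_subset (R := R) (c := c) (s := s) (x := x) (v := v) S)
    -- A node without candidates makes no proposal, so failure gives no information about it; its
    -- factor is zero because `β > 0`.
    rcases (cand G c s v).eq_empty_or_nonempty with he | hne
    · have : (cand G c (R.step c s x) v).card = 0 := by
        rw [he] at hsub; simpa using hsub
      rw [this, Nat.cast_zero, Real.zero_rpow hβ.ne']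
      exact h0 _ _ _
    · have hp : R.proposal c s x v = some (R.pick v (cand G c s v) (x v)) :=
        if_pos ⟨hs v hv, hS v hv, hne⟩
      have hm := hit_of_failure hf hp
      simp only [h]
      rw [if_pos (Finset.mem_inter.2 ⟨(of_proposal hp).2.2, hm⟩)]
      gcongr
  calc _ ≤ ∑ x : V → Y, ∏ v ∈ S, h v x (x v) := Finset.sum_le_sum fun x _ => hle x
    _ ≤ Fintype.card (V → Y) * ∏ v ∈ S, (lam * ((cand G c s v).card : ℝ) ^ β) := by
        refine sum_prod_le S h ?_ h0 _ ?_
        · intro v _ x z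
          simp only [h, hit_piecewise]
        · intro v _ x
          exact sum_pick_le R hβ hlam v _ _ adj_of_mem_cand
    _ = _ := by
        rw [Finset.prod_mul_distrib, Finset.prod_const, potential, if_pos hs]
        ring

end ProposalRule

/-! ### Survival of a set of edges through stages. -/

namespace ProposalRule

variable {V Y : Type*} [Fintype V] [Fintype Y] {G : SimpleGraph V} (R : ProposalRule G Y)

section Stage

variable [Inhabited Y]

/-- `T` iterations with the same colours. -/
noncomputable def stage (T : ℕ) (s : V → Option V) (y : V → Bool × (Fin T → Y)) : V → Option V :=
  runSteps (R.step fun v => (y v).1) s (fun t v => extendSeq (y v).2 t) T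

/-- No edge `{a, m a}` with `a ∈ F` has a matched endpoint. -/
def Untouched (m : V → V) (F : Finset V) (s : V → Option V) : Prop :=
  ∀ a ∈ F, s a = none ∧ s (m a) = none

/-- The parameters of a stage make it unlikely that a left node is unmatched at its end and has an
unmatched right neighbour. -/
structure GoodParameters (Δ T : ℕ) (β lam : ℝ) : Prop where
  pos : 0 < β
  nonneg : 0 ≤ lam
  le : ∀ t : ℝ, 0 ≤ t → t ≤ 1 → (1 - t) * t ^ β ≤ lam
  half : lam ^ T * (Δ : ℝ) ^ β ≤ 1 / 2

variable {R} {c : V → Bool} {s : V → Option V}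

omit [Inhabited Y] in
theorem runSteps_none {ω : ℕ → V → Y} {k : ℕ} {v : V}
    (h : runSteps (R.step c) s ω k v = none) : s v = none := by
  induction k with
  | zero => exact h
  | succ k ih => exact ih (eq_none_of_step h)

theorem potential_le {Δ : ℕ} (hG : ∀ v (A : Finset V), (∀ u ∈ A, G.Adj v u) → A.card ≤ Δ) {β : ℝ}
    (hβ : 0 < β) (S : Finset V) : potential G c β S s ≤ ((Δ : ℝ) ^ β) ^ S.card := by
  unfold potential
  split_ifs
  · rw [← Finset.prod_const]
    refine Finset.prod_le_prod (fun v _ => by positivity) fun v _ => ?_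
    have := hG v _ (adj_of_mem_cand (c := c) (s := s))
    gcongr
  · positivity

theorem one_le_potential {β : ℝ} (hβ : 0 < β) {S : Finset V} (h1 : ∀ v ∈ S, s v = none)
    (h2 : ∀ v ∈ S, (cand G c s v).Nonempty) : 1 ≤ potential G c β S s := by
  rw [potential, if_pos h1]
  calc (1 : ℝ) = ∏ v ∈ S, 1 := by simp
    _ ≤ _ := by
      refine Finset.prod_le_prod (fun _ _ => zero_le_one) fun v hv => ?_
      exact Real.one_le_rpow (by exact_mod_cast (h2 v hv).card_pos) hβ.le

omit [Fintype V] [Fintype Y] in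
theorem extendSeq_swap {T : ℕ} (ω : Fin T → V → Y) (t : ℕ) (v : V) :
    extendSeq (fun i => ω i v) t = extendSeq ω t v := by
  unfold extendSeq
  split_ifs <;> rfl

open Classical in
/-- The left endpoints of the edges `{a, m a}`, `a ∈ F`, with endpoints of different colours. -/
noncomputable def leftEnds (c : V → Bool) (m : V → V) (F : Finset V) : Finset V :=
  (F.filter fun a => c a ≠ c (m a)).image fun a => if c a = true then a else m a

omit [Fintype V] in
open Classical in
theorem leftEnds_spec {m : V → V} {F : Finset V} {v : V} (hv : v ∈ leftEnds c m F) :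
    ∃ a ∈ F, (v = a ∧ c a = true ∧ c (m a) = false) ∨
      (v = m a ∧ c (m a) = true ∧ c a = false) := by
  obtain ⟨a, ha, rfl⟩ := Finset.mem_image.1 hv
  obtain ⟨haF, hne⟩ := Finset.mem_filter.1 ha
  refine ⟨a, haF, ?_⟩
  cases h1 : c a <;> cases h2 : c (m a) <;> simp_all

omit [Fintype V] in
open Classical in
theorem card_leftEnds {m : V → V} {F : Finset V} (hinj : Set.InjOn m F)
    (hdisj : ∀ a ∈ F, m a ∉ F) :
    (leftEnds c m F).card = (F.filter fun a => c a ≠ c (m a)).card := by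
  refine Finset.card_image_of_injOn ?_
  intro a ha b hb hab
  have ha' : a ∈ F := (Finset.mem_filter.1 ha).1
  have hb' : b ∈ F := (Finset.mem_filter.1 hb).1
  dsimp only at hab
  split_ifs at hab
  · exact hab
  · exact absurd ha' (hab ▸ hdisj b hb')
  · exact absurd hb' (hab ▸ hdisj a ha')
  · exact hinj ha' hb' hab

-- If `F` is untouched, each left end is unmatched and its partner is an unmatched right neighbour,
-- so the potential of `leftEnds` is at least 1 and bounds the indicator. The choice of `T` absorbs
-- the initial potential, leaving 1/2 per left end.
open Classical in
theorem sum_iterations_le (R : ProposalRule G Y) {Δ T : ℕ} {β lam : ℝ}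
    (hG : ∀ v (A : Finset V), (∀ u ∈ A, G.Adj v u) → A.card ≤ Δ)
    (hp : GoodParameters Δ T β lam) {m : V → V} {F : Finset V} (hadj : ∀ a ∈ F, G.Adj a (m a))
    (c : V → Bool) (s : V → Option V) :
    ∑ ω : V → Fin T → Y,
      (if Untouched m F (runSteps (R.step c) s (fun t v => extendSeq (ω v) t) T) then (1 : ℝ)
        else 0) ≤
      (1 / 2) ^ (leftEnds c m F).card * Fintype.card (V → Fin T → Y) := by
  set S := leftEnds c m F with hSdef
  have hS : ∀ v ∈ S, c v = true := by
    intro v hv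
    obtain ⟨a, -, ⟨rfl, h, -⟩ | ⟨rfl, h, -⟩⟩ := leftEnds_spec hv <;> exact h
  have hle : ∀ s : V → Option V, (if Untouched m F s then (1 : ℝ) else 0) ≤ potential G c β S s := by
    intro s
    split_ifs with h
    swap
    · exact potential_nonneg _ _
    refine one_le_potential hp.pos ?_ ?_
    · intro v hv
      obtain ⟨a, ha, ⟨rfl, -⟩ | ⟨rfl, -⟩⟩ := leftEnds_spec hv
      exacts [(h _ ha).1, (h _ ha).2]
    · intro v hv
      obtain ⟨a, ha, ⟨rfl, -, h2⟩ | ⟨rfl, -, h2⟩⟩ := leftEnds_spec hv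
      exacts [⟨m v, mem_cand.2 ⟨hadj _ ha, (h _ ha).2, h2⟩⟩,
        ⟨a, mem_cand.2 ⟨(hadj _ ha).symm, (h _ ha).1, h2⟩⟩]
  have hstep := sum_runSteps_le (R.step c) (potential G c β S)
    (ρ := lam ^ S.card) (pow_nonneg hp.nonneg _)
    (fun s => sum_potential_step_le R hp.pos hp.le S hS s) s T
  rw [← (Equiv.piComm fun (_ : Fin T) (_ : V) => Y).sum_comp]
  calc _ ≤ ∑ ω : Fin T → V → Y, potential G c β S (runSteps (R.step c) s (extendSeq ω) T) := by
        refine Finset.sum_le_sum fun ω _ => ?_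
        have : (fun t v => extendSeq ((Equiv.piComm fun (_ : Fin T) (_ : V) => Y) ω v) t) =
            extendSeq ω := by
          funext t v
          exact extendSeq_swap ω t v
        rw [this]
        exact hle _
    _ ≤ _ := hstep
    _ ≤ (lam ^ S.card) ^ T * (Fintype.card (V → Y) : ℝ) ^ T * ((Δ : ℝ) ^ β) ^ S.card := by
        have := hp.nonneg
        gcongr
        exact potential_le hG hp.pos S
    _ = (lam ^ T * (Δ : ℝ) ^ β) ^ S.card * Fintype.card (V → Fin T → Y) := by
        simp only [Fintype.card_fun, Fintype.card_fin, Nat.cast_pow]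
        rw [mul_pow, ← pow_mul, ← pow_mul, ← pow_mul, ← pow_mul, mul_comm T S.card,
          mul_comm T (Fintype.card V)]
        ring
    _ ≤ _ := by
        have := hp.nonneg
        have := hp.half
        gcongr

-- Partners lie outside `F`. With the colours outside `F` fixed, each edge independently contributes
-- 1/2 or 1 with equal probability, on average 3/4.
open Classical in
theorem sum_colourings_le {m : V → V} {F : Finset V} (hinj : Set.InjOn m F)
    (hdisj : ∀ a ∈ F, m a ∉ F) :
    ∑ c : V → Bool, (1 / 2 : ℝ) ^ (leftEnds c m F).card ≤
      (3 / 4) ^ F.card * Fintype.card (V → Bool) := by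
  let h : V → (V → Bool) → Bool → ℝ := fun v c z =>
    if v ∈ F ∧ z ≠ c (m v) then 1 / 2 else 1
  have h1 : ∀ c : V → Bool, (1 / 2 : ℝ) ^ (leftEnds c m F).card = ∏ v ∈ F, h v c (c v) := by
    intro c
    rw [card_leftEnds hinj hdisj, ← Finset.prod_const, Finset.prod_filter]
    refine Finset.prod_congr rfl fun v hv => ?_
    simp [h, hv]
  simp only [h1]
  refine (sum_prod_le F h ?_ ?_ (fun _ => 3 / 4) ?_).trans_eq ?_
  · intro v hv x z
    have : F.piecewise z x (m v) = x (m v) := Finset.piecewise_eq_of_notMem _ _ _ (hdisj v hv)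
    simp only [h, this]
  · intro v x z
    simp only [h]
    split_ifs <;> norm_num
  · intro v hv x
    cases hx : x (m v) <;> simp [h, hv, hx] <;> norm_num
  · rw [Finset.prod_const, mul_comm]

-- The indicator on the right, legitimate because matched nodes stay matched, makes the bound
-- iterable by `sum_runSteps_le`.
open Classical in
theorem sum_stage_le (R : ProposalRule G Y) {Δ T : ℕ} {β lam : ℝ}
    (hG : ∀ v (A : Finset V), (∀ u ∈ A, G.Adj v u) → A.card ≤ Δ)
    (hp : GoodParameters Δ T β lam) {m : V → V} {F : Finset V} (hadj : ∀ a ∈ F, G.Adj a (m a))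
    (hinj : Set.InjOn m F) (hdisj : ∀ a ∈ F, m a ∉ F) (s : V → Option V) :
    ∑ y, (if Untouched m F (R.stage T s y) then (1 : ℝ) else 0) ≤
      (3 / 4) ^ F.card * Fintype.card (V → Bool × (Fin T → Y)) *
        (if Untouched m F s then 1 else 0) := by
  by_cases hs : Untouched m F s
  swap
  · rw [if_neg hs, mul_zero, Finset.sum_eq_zero]
    intro y _
    refine if_neg fun h => hs fun a ha => ⟨?_, ?_⟩
    exacts [runSteps_none (h a ha).1, runSteps_none (h a ha).2]
  rw [if_pos hs, mul_one,
    ← (Equiv.arrowProdEquivProdArrow V (fun _ => Bool) (fun _ => Fin T → Y)).symm.sum_comp,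
    Fintype.sum_prod_type]
  calc _ ≤ ∑ c : V → Bool, (1 / 2 : ℝ) ^ (leftEnds c m F).card *
          Fintype.card (V → Fin T → Y) :=
        Finset.sum_le_sum fun c _ => sum_iterations_le R hG hp hadj c s
    _ ≤ _ := by
        rw [← Finset.sum_mul,
          Fintype.card_congr (Equiv.arrowProdEquivProdArrow V (fun _ => Bool) (fun _ => Fin T → Y)),
          Fintype.card_prod, Nat.cast_mul, ← mul_assoc]
        gcongr
        exact sum_colourings_le hinj hdisj

/-- The partners after `J` stages of `T` iterations. -/
noncomputable def final (R : ProposalRule G Y) (J T : ℕ) (w : V → Fin J → Bool × (Fin T → Y)) :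
    V → Option V :=
  runSteps (R.stage T) (fun _ => none) (fun j v => extendSeq (w v) j) J

open Classical in
theorem sum_final_le (R : ProposalRule G Y) {Δ J T : ℕ} {β lam : ℝ}
    (hG : ∀ v (A : Finset V), (∀ u ∈ A, G.Adj v u) → A.card ≤ Δ)
    (hp : GoodParameters Δ T β lam) {m : V → V} {F : Finset V} (hadj : ∀ a ∈ F, G.Adj a (m a))
    (hinj : Set.InjOn m F) (hdisj : ∀ a ∈ F, m a ∉ F) :
    ∑ w, (if Untouched m F (R.final J T w) then (1 : ℝ) else 0) ≤
      ((3 / 4) ^ F.card) ^ J * Fintype.card (V → Fin J → Bool × (Fin T → Y)) := by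
  rw [← (Equiv.piComm fun (_ : Fin J) (_ : V) => Bool × (Fin T → Y)).sum_comp]
  have h := sum_runSteps_le (R.stage T) (fun s => if Untouched m F s then (1 : ℝ) else 0)
    (ρ := (3 / 4) ^ F.card) (by positivity)
    (fun s => sum_stage_le R hG hp hadj hinj hdisj s) (fun _ => none) J
  have h0 : Untouched m F fun _ => none := fun _ _ => ⟨rfl, rfl⟩
  simp only [if_pos h0, mul_one] at h
  refine (Eq.trans_le ?_ h).trans_eq ?_
  · refine Finset.sum_congr rfl fun ω _ => ?_
    have : (fun t v => extendSeq
        ((Equiv.piComm fun (_ : Fin J) (_ : V) => Bool × (Fin T → Y)) ω v) t) = extendSeq ω := by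
      funext t v
      exact extendSeq_swap ω t v
    rw [final, this]
  · congr 1
    rw [Fintype.card_congr (Equiv.piComm fun (_ : V) (_ : Fin J) => Bool × (Fin T → Y)),
      Fintype.card_fun (α := Fin J), Fintype.card_fin, Nat.cast_pow]

-- Union bound: the untouched edges themselves form one of at most `2 ^ |F|` subsets of size at
-- least `δ |F|`, and each such subset survives all stages with probability at most `(3/4) ^ (δ J
-- |F|)`.
open Classical in
theorem card_many_untouched_le (R : ProposalRule G Y) {Δ J T : ℕ} {β lam δ : ℝ}
    (hG : ∀ v (A : Finset V), (∀ u ∈ A, G.Adj v u) → A.card ≤ Δ)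
    (hp : GoodParameters Δ T β lam) {m : V → V} {F : Finset V} (hadj : ∀ a ∈ F, G.Adj a (m a))
    (hinj : Set.InjOn m F) (hdisj : ∀ a ∈ F, m a ∉ F) :
    ((Finset.univ.filter fun w => δ * F.card ≤ (F.filter fun a =>
      R.final J T w a = none ∧ R.final J T w (m a) = none).card).card : ℝ) ≤
      (2 * (3 / 4) ^ (δ * J)) ^ F.card * Fintype.card (V → Fin J → Bool × (Fin T → Y)) := by
  set K : ℝ := (Fintype.card (V → Fin J → Bool × (Fin T → Y)) : ℝ)
  rw [Finset.card_filter, Nat.cast_sum]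
  calc _ ≤ ∑ w, ∑ F' ∈ F.powerset.filter fun F' => δ * F.card ≤ F'.card,
          (if Untouched m F' (R.final J T w) then (1 : ℝ) else 0) := by
        refine Finset.sum_le_sum fun w _ => ?_
        by_cases h : δ * F.card ≤ (F.filter fun a =>
          R.final J T w a = none ∧ R.final J T w (m a) = none).card
        · rw [if_pos h, Nat.cast_one]
          have hu : Untouched m (F.filter fun a =>
              R.final J T w a = none ∧ R.final J T w (m a) = none) (R.final J T w) :=
            fun a ha => (Finset.mem_filter.1 ha).2
          have := Finset.single_le_sum
            (s := F.powerset.filter fun F' => δ * F.card ≤ F'.card)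
            (f := fun F' => if Untouched m F' (R.final J T w) then (1 : ℝ) else 0)
            (fun F' _ => by positivity)
            (Finset.mem_filter.2 ⟨Finset.mem_powerset.2 (Finset.filter_subset _ _), h⟩)
          rw [if_pos hu] at this
          exact this
        · rw [if_neg h, Nat.cast_zero]
          exact Finset.sum_nonneg fun F' _ => by positivity
    _ = ∑ F' ∈ F.powerset.filter fun F' => δ * F.card ≤ F'.card, ∑ w,
          (if Untouched m F' (R.final J T w) then (1 : ℝ) else 0) := Finset.sum_comm
    _ ≤ ∑ F' ∈ F.powerset.filter fun F' => δ * F.card ≤ F'.card,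
          ((3 / 4 : ℝ) ^ (δ * J)) ^ F.card * K := by
        refine Finset.sum_le_sum fun F' hF' => ?_
        obtain ⟨hsub, hcard⟩ := Finset.mem_filter.1 hF'
        have hsub := Finset.mem_powerset.1 hsub
        refine (sum_final_le R hG hp (fun a ha => hadj a (hsub ha))
          (hinj.mono (Finset.coe_subset.2 hsub))
          (fun a ha h => hdisj a (hsub ha) (hsub h))).trans ?_
        gcongr
        rw [← pow_mul, ← Real.rpow_natCast, ← Real.rpow_natCast, ← Real.rpow_mul (by norm_num)]
        apply Real.rpow_le_rpow_of_exponent_ge (by norm_num) (by norm_num)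
        push_cast
        nlinarith [Nat.cast_nonneg (α := ℝ) J]
    _ ≤ 2 ^ F.card * (((3 / 4 : ℝ) ^ (δ * J)) ^ F.card * K) := by
        rw [Finset.sum_const, nsmul_eq_mul]
        gcongr
        have := Finset.card_filter_le F.powerset fun F' => δ * F.card ≤ F'.card
        rw [Finset.card_powerset] at this
        exact_mod_cast this
    _ = _ := by rw [mul_pow]; ring

open Classical in
theorem natCard_many_untouched_le (R : ProposalRule G Y) {Δ J T : ℕ} {β lam δ : ℝ}
    (hG : ∀ v (A : Finset V), (∀ u ∈ A, G.Adj v u) → A.card ≤ Δ)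
    (hp : GoodParameters Δ T β lam) {m : V → V} {F : Finset V} (hadj : ∀ a ∈ F, G.Adj a (m a))
    (hinj : Set.InjOn m F) (hdisj : ∀ a ∈ F, m a ∉ F) :
    (Nat.card {w // δ * F.card ≤ (F.filter fun a =>
      R.final J T w a = none ∧ R.final J T w (m a) = none).card} : ℝ) ≤
      (2 * (3 / 4) ^ (δ * J)) ^ F.card * Nat.card (V → Fin J → Bool × (Fin T → Y)) := by
  rw [Nat.card_eq_fintype_card, Nat.card_eq_fintype_card, Fintype.card_subtype]
  exact card_many_untouched_le R hG hp hadj hinj hdisj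

end Stage

end ProposalRule

/-! ### The choice of the parameters and the number of iterations. -/

theorem exists_goodParameters : ∃ (T : ℕ → ℕ) (c : ℝ), 0 ≤ c ∧
    (∀ Δ, ∃ β lam, ProposalRule.GoodParameters Δ (T Δ) β lam) ∧
    (∀ Δ, Δ ≤ 2 → (T Δ : ℝ) ≤ c) ∧
    ∀ Δ, 3 ≤ Δ → (T Δ : ℝ) ≤ c * (Real.log Δ / Real.log (Real.log Δ)) := by
  have hlog : ∀ Δ : ℕ, 3 ≤ Δ → 1 < Real.log Δ := by
    intro Δ hΔ
    have h3 : (3 : ℝ) ≤ Δ := by exact_mod_cast hΔ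
    rw [Real.lt_log_iff_exp_lt (by linarith)]
    linarith [Real.exp_one_lt_d9]
  -- Replacing `Δ` by `max Δ 3` keeps the iterated logarithm positive.
  let T : ℕ → ℕ := fun Δ =>
    ⌈4 * (Real.log (max Δ 3 : ℕ) / Real.log (Real.log (max Δ 3 : ℕ)))⌉₊
  -- Rounding up costs at most 1, which the ratio itself dominates, so 4 becomes 5; `T 3` covers `Δ
  -- ≤ 2`.
  refine ⟨T, 5 + T 3, by positivity, fun Δ => ?_, fun Δ hΔ => ?_, fun Δ hΔ => ?_⟩
  · set D := max Δ 3 with hD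
    set l := Real.log D with hl
    have hl1 : 1 < l := hlog D (le_max_right _ _)
    have hl0 : 0 < l := by linarith
    have hll : 0 < Real.log l := Real.log_pos hl1
    have hD0 : (0 : ℝ) < D := by
      have : 3 ≤ D := le_max_right _ _
      exact_mod_cast (by omega : 0 < D)
    -- The exponent `1 / l` makes `D ^ β = e`, while `lam = l ^ (-1 / (2 l))` is the value of `t ^
    -- β` at `t = 1 / √l`.
    refine ⟨1 / l, Real.exp (-(Real.log l / (2 * l))), by positivity, (Real.exp_pos _).le, ?_, ?_⟩
    · intro t ht0 ht1
      set q := Real.sqrt l with hq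
      have hq0 : 0 < q := Real.sqrt_pos.2 hl0
      have hqq : q * q = l := Real.mul_self_sqrt hl0.le
      have hlq : Real.log l = 2 * Real.log q := by
        rw [← hqq, Real.log_mul hq0.ne' hq0.ne']; ring
      -- For small `t` the factor `t ^ β` suffices. For large `t`, `1 - t ≤ exp (-1 / q)` does,
      -- since `log l / (2 l) = log q / q ^ 2 ≤ 1 / q`.
      rcases le_total t (1 / q) with h | h
      · have h1 : t ^ (1 / l) ≤ (1 / q) ^ (1 / l) := by gcongr
        have h2 : (1 / q) ^ (1 / l) = Real.exp (-(Real.log l / (2 * l))) := by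
          rw [Real.rpow_def_of_pos (by positivity), one_div, Real.log_inv, hlq]
          congr 1
          field_simp
        rw [← h2]
        have h3 : 0 ≤ t ^ (1 / l) := Real.rpow_nonneg ht0 _
        nlinarith
      · have h1 : t ^ (1 / l) ≤ 1 := Real.rpow_le_one ht0 ht1 (by positivity)
        have h2 : 1 - t ≤ Real.exp (-(1 / q)) := by
          have := Real.add_one_le_exp (-(1 / q))
          linarith
        have h3 : Real.exp (-(1 / q)) ≤ Real.exp (-(Real.log l / (2 * l))) := by
          apply Real.exp_le_exp.2
          have h4 : Real.log q ≤ q := (Real.log_le_sub_one_of_pos hq0).trans (by linarith)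
          rw [neg_le_neg_iff, hlq, ← hqq, div_le_div_iff₀ (by positivity) hq0]
          nlinarith
        have h5 : 0 ≤ 1 - t := by linarith
        nlinarith
    · have hT : 4 * (l / Real.log l) ≤ T Δ := Nat.le_ceil _
      -- The constant 4 in `T` yields `exp (-2)`, which against `D ^ β = e` leaves `1 / e ≤ 1 / 2`.
      have h1 : Real.exp (-(Real.log l / (2 * l))) ^ T Δ ≤ Real.exp (-2) := by
        rw [← Real.exp_nat_mul]
        apply Real.exp_le_exp.2
        have : 4 * (l / Real.log l) * (Real.log l / (2 * l)) = 2 := by field_simp; norm_num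
        have h2 : 0 ≤ Real.log l / (2 * l) := by positivity
        nlinarith
      have h2 : (Δ : ℝ) ^ (1 / l) ≤ Real.exp 1 := by
        calc (Δ : ℝ) ^ (1 / l) ≤ (D : ℝ) ^ (1 / l) := by
              have : (Δ : ℝ) ≤ D := by exact_mod_cast le_max_left _ _
              gcongr
          _ = Real.exp 1 := by
              rw [Real.rpow_def_of_pos hD0, ← hl]
              congr 1
              field_simp
      calc _ ≤ Real.exp (-2) * Real.exp 1 := by gcongr
        _ = (Real.exp 1)⁻¹ := by rw [← Real.exp_add, ← Real.exp_neg]; norm_num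
        _ ≤ 1 / 2 := by
            rw [one_div]
            apply inv_anti₀ (by norm_num)
            linarith [Real.add_one_le_exp (1 : ℝ)]
  · have : T Δ = T 3 := by simp only [T]; rw [max_eq_right (by omega), max_self]
    rw [this]; linarith
  · have hl1 := hlog Δ hΔ
    set l := Real.log Δ with hl
    have hll : 0 < Real.log l := Real.log_pos hl1
    have h1 : (T Δ : ℝ) ≤ 4 * (l / Real.log l) + 1 := by
      simp only [T]
      rw [max_eq_left hΔ]
      exact (Nat.ceil_lt_add_one (by positivity)).le
    have h2 : 1 ≤ l / Real.log l := by
      rw [one_le_div hll]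
      linarith [Real.log_le_sub_one_of_pos (by linarith : 0 < l)]
    have : (0 : ℝ) ≤ T 3 := Nat.cast_nonneg _
    nlinarith

/-! ### Exactly uniform choices, and ports. -/

/-- The entry of `P` whose position in increasing order is `y` modulo the size of `P`. -/
noncomputable def choosePort (P : Finset ℕ) (y : ℕ) : ℕ :=
  if h : 0 < P.card then P.orderIsoOfFin rfl ⟨y % P.card, Nat.mod_lt _ h⟩ else 0

theorem choosePort_mem {P : Finset ℕ} (h : P.Nonempty) (y : ℕ) : choosePort P y ∈ P := by
  rw [choosePort, dif_pos h.card_pos]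
  exact Subtype.property _

/-- Since `|P|` divides `D`, every residue modulo `|P|` is attained equally often. -/
theorem card_choosePort {P Q : Finset ℕ} (hQ : Q ⊆ P) (h : P.Nonempty) {D : ℕ} (hD : P.card ∣ D) :
    (Finset.univ.filter fun y : Fin D => choosePort P y ∈ Q).card * P.card = D * Q.card := by
  obtain ⟨k, rfl⟩ := hD
  rw [mul_comm P.card k]
  have h1 : (Finset.univ.filter fun y : Fin (k * P.card) => choosePort P y ∈ Q) =
      (Finset.univ ×ˢ Finset.univ.filter fun i : Fin P.card =>
        (P.orderIsoOfFin rfl i : ℕ) ∈ Q).map finProdFinEquiv.toEmbedding := by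
    ext y
    obtain ⟨⟨a, b⟩, rfl⟩ := finProdFinEquiv.surjective y
    simp only [Finset.mem_filter, Finset.mem_univ, true_and, Finset.mem_map_equiv,
      Equiv.symm_apply_apply, Finset.mem_product]
    rw [choosePort, dif_pos h.card_pos]
    have : (⟨(finProdFinEquiv (a, b) : ℕ) % P.card, Nat.mod_lt _ h.card_pos⟩ : Fin P.card) = b := by
      ext
      simp [finProdFinEquiv, Nat.add_mul_mod_self_left, Nat.mod_eq_of_lt b.2]
    rw [this]
  have h2 : (Finset.univ.filter fun i : Fin P.card => (P.orderIsoOfFin rfl i : ℕ) ∈ Q).card =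
      Q.card := by
    refine Finset.card_bij (fun i _ => (P.orderIsoOfFin rfl i : ℕ)) (fun i hi => (Finset.mem_filter.1 hi).2)
      (fun i _ j _ hij => (P.orderIsoOfFin rfl).injective (Subtype.ext hij)) fun q hq => ?_
    have he : ((P.orderIsoOfFin rfl ((P.orderIsoOfFin rfl).symm ⟨q, hQ hq⟩) : P) : ℕ) = q := by
      rw [OrderIso.apply_symm_apply]
    exact ⟨(P.orderIsoOfFin rfl).symm ⟨q, hQ hq⟩,
      Finset.mem_filter.2 ⟨Finset.mem_univ _, he.symm ▸ hq⟩, he⟩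
  rw [h1, Finset.card_map, Finset.card_product, h2, Finset.card_univ, Fintype.card_fin]
  ring

namespace Network

variable {n : ℕ} (N : Network n)

open Classical in
/-- The port of `v` that leads to its neighbour `u`. -/
noncomputable def portTo (v u : Fin n) : ℕ :=
  if h : N.graph.Adj v u then N.port v ⟨u, h⟩ else 0

/-- The neighbour of `v` at port `p`. -/
noncomputable def nodeAt (v : Fin n) (p : ℕ) : Fin n :=
  if h : p < N.degree v then (N.port v).symm ⟨p, h⟩ else v

variable {N} {u v : Fin n}

theorem portTo_lt (h : N.graph.Adj v u) : N.portTo v u < N.degree v := by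
  rw [portTo, dif_pos h]
  exact Fin.is_lt _

theorem nodeAt_portTo (h : N.graph.Adj v u) : N.nodeAt v (N.portTo v u) = u := by
  have : (⟨N.portTo v u, portTo_lt h⟩ : Fin (Nat.card (N.graph.neighborSet v))) =
      N.port v ⟨u, h⟩ := Fin.ext (dif_pos h)
  rw [nodeAt, dif_pos (portTo_lt h)]
  exact congrArg Subtype.val ((Equiv.symm_apply_eq _).2 this)

theorem adj_nodeAt {p : ℕ} (h : p < N.degree v) : N.graph.Adj v (N.nodeAt v p) := by
  rw [nodeAt, dif_pos h]
  exact Subtype.property _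

theorem portTo_nodeAt {p : ℕ} (h : p < N.degree v) : N.portTo v (N.nodeAt v p) = p := by
  rw [portTo, dif_pos (adj_nodeAt h)]
  have : (⟨N.nodeAt v p, adj_nodeAt h⟩ : N.graph.neighborSet v) = (N.port v).symm ⟨p, h⟩ :=
    Subtype.ext (dif_pos h)
  rw [this]
  exact congrArg Fin.val (Equiv.apply_symm_apply (N.port v) ⟨p, h⟩)

theorem portTo_inj {u' : Fin n} (h : N.graph.Adj v u) (h' : N.graph.Adj v u')
    (he : N.portTo v u = N.portTo v u') : u = u' := by
  rw [← nodeAt_portTo h, he, nodeAt_portTo h']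

theorem inbox_portTo (msg : Fin n → ℕ → List Bool) (h : N.graph.Adj v u) :
    N.inbox msg v (N.portTo v u) = msg u (N.portTo u v) := by
  have key : ∀ w : N.graph.neighborSet v, (w : Fin n) = u →
      msg w (N.port w ⟨v, SimpleGraph.Adj.symm w.2⟩) = msg u (N.portTo u v) := by
    rintro ⟨w, hw⟩ rfl
    have e : N.portTo w v = N.port w ⟨v, SimpleGraph.Adj.symm hw⟩ :=
      dif_pos (SimpleGraph.Adj.symm hw)
    exact congrArg (msg w) e.symm
  refine (dif_pos (portTo_lt h)).trans (key _ ?_)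
  have := nodeAt_portTo h
  rwa [nodeAt, dif_pos (portTo_lt h)] at this

theorem portTo_injOn {A : Finset (Fin n)} (hA : ∀ u ∈ A, N.graph.Adj v u) :
    Set.InjOn (N.portTo v) A := fun _ hu _ hu' h => portTo_inj (hA _ hu) (hA _ hu') h

theorem lt_degree_of_mem_image {A : Finset (Fin n)} (hA : ∀ u ∈ A, N.graph.Adj v u) {p : ℕ}
    (hp : p ∈ A.image (N.portTo v)) : p < N.degree v := by
  obtain ⟨u, hu, rfl⟩ := Finset.mem_image.1 hp
  exact portTo_lt (hA u hu)

open Classical in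
theorem filter_inbox (msg : Fin n → ℕ → List Bool) (v : Fin n) :
    ((Finset.range (N.degree v)).filter fun p => N.inbox msg v p = [true]) =
      (Finset.univ.filter fun u => N.graph.Adj v u ∧ msg u (N.portTo u v) = [true]).image
        (N.portTo v) := by
  ext p
  simp only [Finset.mem_filter, Finset.mem_range, Finset.mem_image, Finset.mem_univ, true_and]
  constructor
  · rintro ⟨hp, h⟩
    refine ⟨N.nodeAt v p, ⟨adj_nodeAt hp, ?_⟩, portTo_nodeAt hp⟩
    rwa [← inbox_portTo msg (adj_nodeAt hp), portTo_nodeAt hp]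
  · rintro ⟨u, ⟨hu, h⟩, rfl⟩
    exact ⟨portTo_lt hu, by rwa [inbox_portTo msg hu]⟩

variable (N) in
theorem card_le_maxDegree (v : Fin n) (A : Finset (Fin n)) (hA : ∀ u ∈ A, N.graph.Adj v u) :
    A.card ≤ N.maxDegree := by
  classical
  refine le_trans ?_ (N.graph.degree_le_maxDegree v)
  exact Finset.card_le_card fun u hu => by simpa using hA u hu

variable (N) in
open Classical in
/-- The local decisions in terms of ports. -/
noncomputable def proposalRule : ProposalRule N.graph (Fin N.maxDegree.factorial) where
  pick v A y := N.nodeAt v (choosePort (A.image (N.portTo v)) y)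
  accept v A := N.nodeAt v (choosePort (A.image (N.portTo v)) 0)
  pick_mem v A y hA hne := by
    obtain ⟨u, hu, h⟩ := Finset.mem_image.1 (choosePort_mem (hne.image (N.portTo v)) y)
    rwa [← h, nodeAt_portTo (hA u hu)]
  accept_mem v A hA hne := by
    obtain ⟨u, hu, h⟩ := Finset.mem_image.1 (choosePort_mem (hne.image (N.portTo v)) 0)
    rwa [← h, nodeAt_portTo (hA u hu)]
  card_pick v A hA hne B hB := by
    have h1 : (A.image (N.portTo v)).card = A.card := Finset.card_image_of_injOn (portTo_injOn hA)
    have h2 : (B.image (N.portTo v)).card = B.card :=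
      Finset.card_image_of_injOn (portTo_injOn fun u hu => hA u (hB hu))
    -- The factorial of the maximum degree is divisible by every possible number of candidates.
    have h := card_choosePort (Finset.image_subset_image hB) (hne.image (N.portTo v))
      (D := N.maxDegree.factorial)
      (Nat.dvd_factorial (hne.image _).card_pos (h1 ▸ N.card_le_maxDegree v A hA))
    rw [h1, h2] at h
    rw [Fintype.card_fin, ← h]
    congr 2
    ext y
    simp only [Finset.mem_filter, Finset.mem_univ, true_and]
    obtain ⟨u, hu, he⟩ := Finset.mem_image.1 (choosePort_mem (hne.image (N.portTo v)) y)
    rw [← he, nodeAt_portTo (hA u hu)]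
    refine ⟨fun h => Finset.mem_image_of_mem _ h, fun h => ?_⟩
    obtain ⟨u', hu', he'⟩ := Finset.mem_image.1 h
    rwa [← portTo_inj (hA _ (hB hu')) (hA u hu) he']

end Network

/-! ### The local program and its random choices. -/

/-- What a node remembers: its degree, the number of completed rounds, its colour and its random
choice in every iteration, the port of its partner, and the ports to which it sent its last proposal
and its last acceptance. -/
structure NodeState where
  deg : ℕ
  time : ℕ
  colour : ℕ → Bool
  choice : ℕ → ℕ
  mate : Option ℕ
  proposal : Option ℕ
  accepted : Option ℕ

namespace NodeState

/-- The message on port `p`: an unmatched right node announces itself, a node proposes, or a node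
accepts a proposal. -/
def message (st : NodeState) (p : ℕ) : List Bool :=
  if st.time % 3 = 0 then [decide (st.mate = none ∧ st.colour (st.time / 3) = false)]
  else if st.time % 3 = 1 then [decide (st.proposal = some p)]
  else [decide (st.accepted = some p)]

open Classical in
/-- The next state when the message `[true]` arrives on the ports in `P`. -/
noncomputable def update (st : NodeState) (P : Finset ℕ) : NodeState :=
  if st.time % 3 = 0 then
    { st with
      time := st.time + 1
      proposal := if st.mate = none ∧ st.colour (st.time / 3) = true ∧ P.Nonempty then
        some (choosePort P (st.choice (st.time / 3))) else none }
  else if st.time % 3 = 1 then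
    { st with
      time := st.time + 1
      accepted := if P.Nonempty then some (choosePort P 0) else none }
  else
    { st with
      time := st.time + 1
      mate := st.mate.or (st.accepted.or (st.proposal.filter fun p => p ∈ P)) }

/-- The next state when the messages `inbox` arrive. -/
noncomputable def next (st : NodeState) (inbox : ℕ → List Bool) : NodeState :=
  st.update ((Finset.range st.deg).filter fun p => inbox p = [true])

end NodeState

/-- The random choices of a node: in each of `J` stages a colour, and in each of the `T` iterations
of a stage a number below `D`. -/
abbrev Choices (J T D : ℕ) : Type := Fin J → Bool × (Fin T → Fin D)

namespace Choices

variable {J T D : ℕ}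

instance : Inhabited (Fin D.factorial) := ⟨⟨0, D.factorial_pos⟩⟩

variable (J T D) in
/-- The seeds enumerate the random choices. -/
noncomputable def equivSeed :
    Fin (Fintype.card (Choices J T D.factorial) - 1 + 1) ≃ Choices J T D.factorial :=
  (finCongr (Nat.sub_add_cancel Fintype.card_pos)).trans (Fintype.equivFin _).symm

variable (J T D) in
/-- The random choices given by a seed. -/
noncomputable def ofSeed (seed : ℕ) : Choices J T D.factorial :=
  equivSeed J T D (Fin.ofNat _ seed)

theorem ofSeed_val (r : Fin (Fintype.card (Choices J T D.factorial) - 1 + 1)) :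
    ofSeed J T D r = equivSeed J T D r := by
  simp [ofSeed]

/-- The colour and the number for iteration `k`, counted from the start of the first stage. -/
def flatten (w : Choices J T D.factorial) (k : ℕ) : Bool × Fin D.factorial :=
  ((extendSeq w (k / T)).1, extendSeq (extendSeq w (k / T)).2 (k % T))

end Choices

namespace ProposalRule

variable {V : Type*} [Fintype V] {D : ℕ} {G : SimpleGraph V} (R : ProposalRule G (Fin D.factorial))

/-- The partners after `k` iterations. -/
noncomputable def matesAt {J T : ℕ} (w : V → Choices J T D.factorial) (k : ℕ) : V → Option V :=
  runSteps (fun s (y : V → Bool × Fin D.factorial) => R.step (fun v => (y v).1) s fun v => (y v).2)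
    (fun _ => none) (fun k v => (w v).flatten k) k

theorem consistent_matesAt {J T : ℕ} (w : V → Choices J T D.factorial) (k : ℕ) :
    Consistent G (R.matesAt w k) := by
  induction k with
  | zero => intro v u h; simp [matesAt, runSteps] at h
  | succ k ih => exact ih.step

theorem runSteps_const_colour (c : V → Bool) (s : V → Option V) (x : ℕ → V → Fin D.factorial)
    (k : ℕ) :
    runSteps (fun s (y : V → Bool × Fin D.factorial) =>
      R.step (fun v => (y v).1) s fun v => (y v).2) s (fun t v => (c v, x t v)) k =
      runSteps (R.step c) s x k := by
  induction k with
  | zero => rfl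
  | succ k ih => simp only [runSteps]; rw [ih]

/-- The program counts iterations consecutively while the analysis groups them into stages;
iteration `j * T + t` uses colour `j` and number `t` of that stage. -/
theorem matesAt_mul {J T : ℕ} (w : V → Choices J T D.factorial) (j : ℕ) :
    R.matesAt w (j * T) =
      runSteps (R.stage T) (fun _ => none) (fun j v => extendSeq (w v) j) j := by
  induction j with
  | zero => rw [zero_mul]; rfl
  | succ j ih =>
    rw [add_mul, one_mul, matesAt, runSteps_add]
    rw [matesAt] at ih
    rw [ih]
    simp only [runSteps]
    rw [stage, ← runSteps_const_colour]
    apply runSteps_congr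
    intro t ht
    funext v
    have h1 : (j * T + t) / T = j := by
      rw [mul_comm, Nat.mul_add_div (by omega), Nat.div_eq_of_lt ht, add_zero]
    have h2 : (j * T + t) % T = t := by
      rw [mul_comm, Nat.mul_add_mod, Nat.mod_eq_of_lt ht]
    simp only [Choices.flatten, h1, h2]

theorem matesAt_end {J T : ℕ} (w : V → Choices J T D.factorial) :
    R.matesAt w (J * T) = R.final J T w := R.matesAt_mul w J

end ProposalRule

/-- The proposal algorithm with `J` stages of `T Δ` iterations. An iteration takes three rounds: the
unmatched right nodes announce themselves, the unmatched left nodes propose to one of them, and the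
right nodes accept one of the proposals. -/
noncomputable def proposalAlgorithm (J : ℕ) (T : ℕ → ℕ) : DistributedAlgorithm where
  State := NodeState
  rounds _ Δ := 3 * (J * T Δ)
  -- Seeds take `seedBound + 1` values, hence the subtraction.
  seedBound _ Δ := Fintype.card (Choices J (T Δ) Δ.factorial) - 1
  init _ Δ _ deg seed :=
    { deg := deg
      time := 0
      colour := fun k => ((Choices.ofSeed J (T Δ) Δ seed).flatten k).1
      choice := fun k => ((Choices.ofSeed J (T Δ) Δ seed).flatten k).2
      mate := none
      proposal := none
      accepted := none }
  send := NodeState.message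
  receive := NodeState.next
  output st := st.mate

/-! ### The message-passing execution simulates the proposal process. -/

namespace proposalAlgorithm

variable {n J : ℕ} {T : ℕ → ℕ} (N : Network n) (r : (proposalAlgorithm J T).Seeds N)

/-- The random choices of the nodes. -/
noncomputable def choices (v : Fin n) : Choices J (T N.maxDegree) N.maxDegree.factorial :=
  Choices.equivSeed J (T N.maxDegree) N.maxDegree (r v)

/-- The partners after `k` iterations. -/
noncomputable def mates (k : ℕ) : Fin n → Option (Fin n) := N.proposalRule.matesAt (choices N r) k

variable (k : ℕ)

/-- The colours in iteration `k`. -/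
noncomputable def colour (v : Fin n) : Bool := ((choices N r v).flatten k).1

/-- The random numbers in iteration `k`. -/
noncomputable def number (v : Fin n) : Fin N.maxDegree.factorial :=
  ((choices N r v).flatten k).2

/-- A node state at time `t` that knows the right partner. -/
structure Describes (t : ℕ) (v : Fin n) (s : Option (Fin n)) (st : NodeState) : Prop where
  deg : st.deg = N.degree v
  time : st.time = t
  colour : ∀ k, st.colour k = colour N r k v
  choice : ∀ k, st.choice k = number N r k v
  mate : st.mate = s.map (N.portTo v)

variable {N r k}

open Classical in
theorem next_announcements {st : Fin n → NodeState} {s : Fin n → Option (Fin n)}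
    (h : ∀ v, Describes N r (3 * k) v (s v) (st v)) (v : Fin n) :
    Describes N r (3 * k + 1) v (s v)
        ((st v).next (N.inbox (fun u q => (st u).message q) v)) ∧
      ((st v).next (N.inbox (fun u q => (st u).message q) v)).proposal =
        (N.proposalRule.proposal (colour N r k) s (number N r k) v).map (N.portTo v) := by
  have h0 : 3 * k % 3 = 0 := by omega
  have h1 : 3 * k / 3 = k := by omega
  obtain ⟨h2, h3, h4, h5, h6⟩ := h v
  have hP : ((Finset.range (N.degree v)).filter fun p =>
      N.inbox (fun u q => (st u).message q) v p = [true]) =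
      (ProposalRule.cand N.graph (colour N r k) s v).image (N.portTo v) := by
    rw [Network.filter_inbox]
    congr 1
    ext u
    simp [ProposalRule.mem_cand, NodeState.message, (h u).time, (h u).mate, (h u).colour, h0, h1]
  rw [NodeState.next, h2, hP, NodeState.update, if_pos (by rw [h3, h0])]
  refine ⟨⟨h2, congrArg (· + 1) h3, h4, h5, h6⟩, ?_⟩
  simp only [ProposalRule.proposal, h3, h1, h6, h4, h5, Option.map_eq_none_iff,
    Finset.image_nonempty]
  split_ifs with hc
  · exact congrArg some (Network.portTo_nodeAt (Network.lt_degree_of_mem_image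
      ProposalRule.adj_of_mem_cand (choosePort_mem (hc.2.2.image _) _))).symm
  · rfl

open Classical in
theorem next_proposals {st : Fin n → NodeState} {s : Fin n → Option (Fin n)}
    (h : ∀ v, Describes N r (3 * k + 1) v (s v) (st v))
    (hp : ∀ v, (st v).proposal =
      (N.proposalRule.proposal (colour N r k) s (number N r k) v).map (N.portTo v)) (v : Fin n) :
    Describes N r (3 * k + 2) v (s v)
        ((st v).next (N.inbox (fun u q => (st u).message q) v)) ∧
      ((st v).next (N.inbox (fun u q => (st u).message q) v)).proposal =
        (N.proposalRule.proposal (colour N r k) s (number N r k) v).map (N.portTo v) ∧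
      ((st v).next (N.inbox (fun u q => (st u).message q) v)).accepted =
        (N.proposalRule.accepted (colour N r k) s (number N r k) v).map (N.portTo v) := by
  have h0 : (3 * k + 1) % 3 = 1 := by omega
  obtain ⟨h2, h3, h4, h5, h6⟩ := h v
  have hP : ((Finset.range (N.degree v)).filter fun p =>
      N.inbox (fun u q => (st u).message q) v p = [true]) =
      (N.proposalRule.incoming (colour N r k) s (number N r k) v).image (N.portTo v) := by
    rw [Network.filter_inbox]
    congr 1
    ext u
    simp only [Finset.mem_filter, Finset.mem_univ, true_and, ProposalRule.mem_incoming]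
    simp only [NodeState.message, (h u).time, h0, hp u, one_ne_zero, if_false, if_true, List.cons.injEq,
      and_true, decide_eq_true_eq, Option.map_eq_some_iff]
    constructor
    · rintro ⟨ha, w, hw, he⟩
      rwa [← Network.portTo_inj
        (ProposalRule.adj_of_mem_cand _ (ProposalRule.of_proposal hw).2.2) ha.symm he]
    · intro hw
      exact ⟨(ProposalRule.adj_of_mem_cand _ (ProposalRule.of_proposal hw).2.2).symm, v, hw, rfl⟩
  rw [NodeState.next, h2, hP, NodeState.update, if_neg (by rw [h3, h0]; norm_num),
    if_pos (by rw [h3, h0])]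
  refine ⟨⟨h2, congrArg (· + 1) h3, h4, h5, h6⟩, hp v, ?_⟩
  simp only [ProposalRule.accepted, Finset.image_nonempty]
  split_ifs with hc
  · exact congrArg some (Network.portTo_nodeAt (Network.lt_degree_of_mem_image
      ProposalRule.adj_of_mem_incoming (choosePort_mem (hc.image _) _))).symm
  · rfl

open Classical in
theorem next_acceptances {st : Fin n → NodeState} {s : Fin n → Option (Fin n)}
    (h : ∀ v, Describes N r (3 * k + 2) v (s v) (st v))
    (hp : ∀ v, (st v).proposal =
      (N.proposalRule.proposal (colour N r k) s (number N r k) v).map (N.portTo v))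
    (ha : ∀ v, (st v).accepted =
      (N.proposalRule.accepted (colour N r k) s (number N r k) v).map (N.portTo v)) (v : Fin n) :
    Describes N r (3 * (k + 1)) v
      (N.proposalRule.step (colour N r k) s (number N r k) v)
      ((st v).next (N.inbox (fun u q => (st u).message q) v)) := by
  have h0 : (3 * k + 2) % 3 = 2 := by omega
  obtain ⟨h2, h3, h4, h5, h6⟩ := h v
  have hadj : ∀ u w, N.proposalRule.accepted (colour N r k) s (number N r k) u = some w →
      N.graph.Adj u w := fun u w hw =>
    (ProposalRule.adj_of_mem_cand _ (ProposalRule.of_proposal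
      (ProposalRule.of_accepted hw)).2.2).symm
  have hP : ((Finset.range (N.degree v)).filter fun p =>
      N.inbox (fun u q => (st u).message q) v p = [true]) =
      (Finset.univ.filter fun u =>
        N.proposalRule.accepted (colour N r k) s (number N r k) u = some v).image
          (N.portTo v) := by
    rw [Network.filter_inbox]
    congr 1
    ext u
    simp only [Finset.mem_filter, Finset.mem_univ, true_and]
    simp only [NodeState.message, (h u).time, h0, ha u, OfNat.ofNat_ne_zero, OfNat.ofNat_ne_one, if_false, List.cons.injEq, and_true,
      decide_eq_true_eq, Option.map_eq_some_iff]
    constructor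
    · rintro ⟨hvu, w, hw, he⟩
      rwa [← Network.portTo_inj (hadj u w hw) hvu.symm he]
    · intro hw
      exact ⟨(hadj u v hw).symm, v, hw, rfl⟩
  rw [NodeState.next, h2, hP, NodeState.update, if_neg (by rw [h3, h0]; norm_num),
    if_neg (by rw [h3, h0]; norm_num)]
  refine ⟨h2, congrArg (· + 1) h3, h4, h5, ?_⟩
  simp only [ProposalRule.step, h6, hp, ha, Option.map_or]
  congr 2
  cases hw : N.proposalRule.proposal (colour N r k) s (number N r k) v with
  | none => rfl
  | some w =>
    have hvw : N.graph.Adj v w :=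
      ProposalRule.adj_of_mem_cand _ (ProposalRule.of_proposal hw).2.2
    have : N.portTo v w ∈ (Finset.univ.filter fun u =>
        N.proposalRule.accepted (colour N r k) s (number N r k) u = some v).image (N.portTo v) ↔
        N.proposalRule.accepted (colour N r k) s (number N r k) w = some v := by
      simp only [Finset.mem_image, Finset.mem_filter, Finset.mem_univ, true_and]
      refine ⟨?_, fun h => ⟨w, h, rfl⟩⟩
      rintro ⟨u, hu, he⟩
      rwa [← Network.portTo_inj (hadj u v hu).symm hvw he]
    by_cases hc : N.proposalRule.accepted (colour N r k) s (number N r k) w = some v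
    · simp only [Option.map_some, Option.filter_some, this, hc, decide_true, if_true]
    · simp only [Option.map_some, Option.filter_some, this, hc, decide_false, Bool.false_eq_true,
        if_false, Option.map_none]

/-- The invariant omits the stored proposal and acceptance, which every iteration overwrites before
using them. -/
theorem describes_stateAt (k : ℕ) (v : Fin n) :
    Describes N r (3 * k) v (mates N r k v)
      ((proposalAlgorithm J T).stateAt N r (3 * k) v : NodeState) := by
  induction k generalizing v with
  | zero =>
    refine ⟨rfl, rfl, fun k => ?_, fun k => ?_, rfl⟩
    · exact congrArg (fun w => (Choices.flatten w k).1) (Choices.ofSeed_val (r v))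
    · exact congrArg (fun w => ((Choices.flatten w k).2 : ℕ)) (Choices.ofSeed_val (r v))
  | succ k ih =>
    have h1 := fun v => next_announcements ih v
    have h2 := fun v => next_proposals (fun v => (h1 v).1) (fun v => (h1 v).2) v
    exact next_acceptances (fun v => (h2 v).1) (fun v => (h2 v).2.1) (fun v => (h2 v).2.2) v

theorem outputAt_eq (v : Fin n) :
    (proposalAlgorithm J T).outputAt N r v =
      (N.proposalRule.final J (T N.maxDegree) (choices N r) v).map (N.portTo v) := by
  rw [← ProposalRule.matesAt_end]
  exact (describes_stateAt (J * T N.maxDegree) v).mate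

theorem length_message (st : NodeState) (p : ℕ) : (st.message p).length = 1 := by
  unfold NodeState.message
  split_ifs <;> rfl

theorem messagesAtMost : (proposalAlgorithm J T).MessagesAtMost N r (1 * Nat.log 2 n) := by
  intro t _ v p hp
  -- For `n ≤ 1` the bound is zero bits, but a port requires a second node.
  have hn : 2 ≤ n := by
    have hne := (Network.adj_nodeAt hp).ne
    have h1 := v.isLt
    have h2 := (N.nodeAt v p).isLt
    by_contra hlt
    exact hne (Fin.ext (by omega))
  refine (length_message _ _).trans_le ?_
  rw [one_mul]
  exact Nat.log_pos one_lt_two hn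

end proposalAlgorithm

/-! ### Comparison of the output with a maximum matching. -/

namespace ProposalRule

variable {V : Type*} {G : SimpleGraph V} {s : V → Option V}

/-- The matching in which every node has the partner recorded by `s`. -/
def Consistent.toSubgraph (h : Consistent G s) : G.Subgraph where
  verts := {v | s v ≠ none}
  Adj v u := s v = some u
  adj_sub hv := (h _ _ hv).1
  edge_vert hv := by simp [hv]
  symm := ⟨fun _ _ hv => (h _ _ hv).2⟩

theorem Consistent.isMatching_toSubgraph (h : Consistent G s) : h.toSubgraph.IsMatching := by
  intro v hv
  obtain ⟨u, hu⟩ := Option.ne_none_iff_exists'.1 hv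
  exact ⟨u, hu, fun w hw => Option.some.inj ((show s v = some w from hw).symm.trans hu)⟩

open Classical in
theorem Consistent.card_matched_le [Fintype V] (h : Consistent G s) :
    (Finset.univ.filter fun v => s v ≠ none).card ≤ 2 * h.toSubgraph.edgeSet.ncard := by
  rw [Set.ncard_eq_toFinset_card']
  refine (Finset.card_le_mul_card_image (f := fun v => s(v, (s v).getD v)) _ 2 ?_).trans ?_
  · intro e _
    have : ∀ v, s(v, (s v).getD v) = e → v ∈ e := by
      rintro v rfl
      exact Sym2.mem_mk_left _ _
    refine (Finset.card_le_card (t := e.toFinset) fun v hv => ?_).trans ?_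
    · exact Sym2.mem_toFinset.2 (this v (Finset.mem_filter.1 hv).2)
    · rw [Sym2.card_toFinset]
      split_ifs <;> omega
  · refine Nat.mul_le_mul_left 2 (Finset.card_le_card fun e he => ?_)
    obtain ⟨v, hv, rfl⟩ := Finset.mem_image.1 he
    obtain ⟨u, hu⟩ := Option.ne_none_iff_exists'.1 (Finset.mem_filter.1 hv).2
    rw [Set.mem_toFinset, hu]
    exact hu

-- Each touched edge is charged to one of its matched endpoints, injectively because the edges are
-- disjoint; an output edge is charged at most twice.
open Classical in
theorem Consistent.card_le [Fintype V] (h : Consistent G s) {m : V → V} {F : Finset V}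
    (hinj : Set.InjOn m F) (hdisj : ∀ a ∈ F, m a ∉ F) :
    F.card ≤ 2 * h.toSubgraph.edgeSet.ncard +
      (F.filter fun a => s a = none ∧ s (m a) = none).card := by
  rw [← Finset.card_filter_add_card_filter_not (s := F) fun a => s a = none ∧ s (m a) = none,
    add_comm]
  refine Nat.add_le_add_right (le_trans ?_ h.card_matched_le) _
  refine Finset.card_le_card_of_injOn (fun a => if s a = none then m a else a) ?_ ?_
  · intro a ha
    have := (Finset.mem_filter.1 ha).2
    simp only [Finset.coe_filter, Finset.mem_univ, true_and, Set.mem_ofPred_eq]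
    split_ifs with h1
    · exact fun h2 => this ⟨h1, h2⟩
    · exact h1
  · intro a ha b hb hab
    have ha' := (Finset.mem_filter.1 ha).1
    have hb' := (Finset.mem_filter.1 hb).1
    dsimp only at hab
    split_ifs at hab
    · exact hinj ha' hb' hab
    · exact absurd hb' (hab ▸ hdisj a ha')
    · exact absurd ha' (hab ▸ hdisj b hb')
    · exact hab

end ProposalRule

theorem SimpleGraph.Subgraph.IsMatching.exists_partner {n : ℕ} {G : SimpleGraph (Fin n)}
    {M : G.Subgraph} (hM : M.IsMatching) : ∃ (m : Fin n → Fin n) (F : Finset (Fin n)),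
      M.edgeSet.ncard ≤ F.card ∧ (∀ a ∈ F, G.Adj a (m a)) ∧ Set.InjOn m F ∧
        ∀ a ∈ F, m a ∉ F := by
  classical
  have h : ∀ v, ∃ u, ∀ w, M.Adj v w ↔ v ∈ M.verts ∧ w = u := by
    intro v
    by_cases hv : v ∈ M.verts
    · obtain ⟨u, hu, huniq⟩ := hM hv
      exact ⟨u, fun w => ⟨fun hw => ⟨hv, huniq w hw⟩, fun hw => hw.2 ▸ hu⟩⟩
    · exact ⟨v, fun w => ⟨fun hw => absurd (M.edge_vert hw) hv, fun hw => absurd hw.1 hv⟩⟩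
  choose m hm using h
  have hadj : ∀ v ∈ M.verts, M.Adj v (m v) := fun v hv => (hm v _).2 ⟨hv, rfl⟩
  have hmm : ∀ v ∈ M.verts, m (m v) = v := fun v hv => ((hm _ _).1 (hadj v hv).symm).2.symm
  -- Each matching edge is represented by its smaller endpoint, so partners fall outside the set.
  refine ⟨m, Finset.univ.filter fun v => v ∈ M.verts ∧ v < m v, ?_, ?_, ?_, ?_⟩
  · have : M.edgeSet ⊆ ((Finset.univ.filter fun v => v ∈ M.verts ∧ v < m v).image
        fun v => s(v, m v) : Finset (Sym2 (Fin n))) := by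
      intro e he
      induction e with
      | _ v w =>
      have hvw : M.Adj v w := he
      obtain ⟨hv, rfl⟩ := (hm v w).1 hvw
      rcases lt_or_gt_of_ne hvw.ne with hlt | hlt
      · exact Finset.mem_coe.2 (Finset.mem_image.2 ⟨v, by simp [hv, hlt], rfl⟩)
      · refine Finset.mem_coe.2 (Finset.mem_image.2 ⟨m v, ?_, ?_⟩)
        · simpa [hmm v hv, hlt] using M.edge_vert hvw.symm
        · rw [hmm v hv, Sym2.eq_swap]
    refine (Set.ncard_le_ncard this (Finset.finite_toSet _)).trans ?_
    rw [Set.ncard_coe_finset]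
    exact Finset.card_image_le
  · intro a ha
    exact (hadj a (Finset.mem_filter.1 ha).2.1).adj_sub
  · intro a ha b hb hab
    rw [← hmm a (Finset.mem_filter.1 ha).2.1, hab, hmm b (Finset.mem_filter.1 hb).2.1]
  · intro a ha hma
    obtain ⟨-, h1, h2⟩ := Finset.mem_filter.1 ha
    have h3 := (Finset.mem_filter.1 hma).2.2
    rw [hmm a h1] at h3
    exact lt_asymm h2 h3

theorem Nat.card_subtype_le_of_equiv {α β : Type*} [Finite β] (e : α ≃ β) {p : α → Prop}
    {q : β → Prop} (h : ∀ a, p a → q (e a)) : Nat.card {a // p a} ≤ Nat.card {b // q b} :=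
  Nat.card_le_card_of_injective (fun a : {a // p a} => (⟨e a.1, h a.1 a.2⟩ : {b // q b}))
    fun _ _ hab => Subtype.ext (e.injective (congrArg Subtype.val hab))

theorem DistributedAlgorithm.one_sub_le_prob {n : ℕ} {A : DistributedAlgorithm} {N : Network n}
    {E : A.Seeds N → Prop} {p : ℝ}
    (h : (Nat.card {r : A.Seeds N // ¬E r} : ℝ) ≤ p * Nat.card (A.Seeds N)) :
    1 - p ≤ A.prob N E := by
  classical
  have hpos : (0 : ℝ) < Nat.card (A.Seeds N) := by exact_mod_cast Nat.card_pos
  rw [prob, le_div_iff₀ hpos]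
  have hsum : Nat.card {r : A.Seeds N // E r} + Nat.card {r : A.Seeds N // ¬E r} =
      Nat.card (A.Seeds N) := by
    rw [← Nat.card_sum, Nat.card_congr (Equiv.sumCompl E)]
  have : (Nat.card {r : A.Seeds N // E r} : ℝ) + Nat.card {r : A.Seeds N // ¬E r} =
      Nat.card (A.Seeds N) := by exact_mod_cast hsum
  linarith

/-! ### The approximation guarantee. -/

namespace proposalAlgorithm

variable {n J : ℕ} {T : ℕ → ℕ} (N : Network n) (r : (proposalAlgorithm J T).Seeds N)

theorem consistent_final :
    ProposalRule.Consistent N.graph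
      (N.proposalRule.final J (T N.maxDegree) (choices N r)) := by
  rw [← ProposalRule.matesAt_end]
  exact ProposalRule.consistent_matesAt _ _ _

theorem computesMatching :
    (proposalAlgorithm J T).ComputesMatching N r (consistent_final N r).toSubgraph := by
  refine ⟨(consistent_final N r).isMatching_toSubgraph, fun v p => ?_⟩
  rw [outputAt_eq, Option.map_eq_some_iff]
  constructor
  · rintro ⟨u, hu, rfl⟩
    have ha := (consistent_final N r v u hu).1
    have he : N.portTo v u = N.port v ⟨u, ha⟩ := dif_pos ha
    exact ⟨⟨u, ha⟩, hu, he.symm⟩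
  · rintro ⟨⟨u, ha⟩, hu, rfl⟩
    have he : N.portTo v u = N.port v ⟨u, ha⟩ := dif_pos ha
    exact ⟨u, hu, he⟩

/-- Independent uniform seeds are independent uniform random choices. -/
noncomputable def seedsEquiv : (proposalAlgorithm J T).Seeds N ≃
    (Fin n → Choices J (T N.maxDegree) N.maxDegree.factorial) :=
  Equiv.piCongrRight fun _ => Choices.equivSeed J (T N.maxDegree) N.maxDegree

theorem seedsEquiv_apply : seedsEquiv N r = choices N r := rfl

/-- The fraction `ε / (2 + ε)` is chosen so that its complement is `2 / (2 + ε)`. -/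
theorem le_of_few_untouched {ε : ℝ} (hε : 0 < ε) {f e b : ℕ} (h1 : f ≤ 2 * e + b)
    (h2 : (b : ℝ) < ε / (2 + ε) * f) : (f : ℝ) ≤ (2 + ε) * (e : ℝ) := by
  have h3 : (f : ℝ) ≤ 2 * e + b := by exact_mod_cast h1
  have h4 : (f : ℝ) - ε / (2 + ε) * f = 2 * (f / (2 + ε)) := by
    field_simp
    ring
  have h5 : (f : ℝ) / (2 + ε) ≤ e := by linarith
  rw [div_le_iff₀ (by positivity)] at h5
  linarith

/-- A failing seed leaves at least a fraction `ε / (2 + ε)` of the optimal edges untouched, and `hJ`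
turns the union bound into `exp (-C)` per edge. -/
theorem prob_approximation {ε C β lam : ℝ} (hε : 0 < ε)
    (hJ : 2 * (3 / 4 : ℝ) ^ (ε / (2 + ε) * J) ≤ Real.exp (-C)) (hC : 0 < C)
    (hp : ProposalRule.GoodParameters N.maxDegree (T N.maxDegree) β lam) :
    1 - Real.exp (-(C * (matchingNumber N.graph : ℝ))) ≤
      (proposalAlgorithm J T).prob N (fun r => ∃ M : N.graph.Subgraph,
        (proposalAlgorithm J T).ComputesMatching N r M ∧
          (matchingNumber N.graph : ℝ) ≤ (2 + ε) * (M.edgeSet.ncard : ℝ)) := by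
  classical
  obtain ⟨⟨M, hM, hcard⟩, -⟩ := matchingNumber_isGreatest N.graph
  obtain ⟨m, F, hF, hadj, hinj, hdisj⟩ := hM.exists_partner
  rw [hcard] at hF
  have hF' : (matchingNumber N.graph : ℝ) ≤ F.card := by exact_mod_cast hF
  refine DistributedAlgorithm.one_sub_le_prob ?_
  have hcount := ProposalRule.natCard_many_untouched_le (J := J) (δ := ε / (2 + ε)) N.proposalRule
    N.card_le_maxDegree hp hadj hinj hdisj
  refine le_trans (Nat.cast_le.2 (Nat.card_subtype_le_of_equiv (seedsEquiv N) fun r hr => ?_))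
    (hcount.trans ?_)
  · refine not_lt.1 fun hlt => ?_
    rw [seedsEquiv_apply] at hlt
    exact hr ⟨_, computesMatching N r,
      hF'.trans (le_of_few_untouched hε ((consistent_final N r).card_le hinj hdisj) hlt)⟩
  rw [Nat.card_congr (seedsEquiv N)]
  refine mul_le_mul_of_nonneg_right ?_ (Nat.cast_nonneg _)
  calc _ ≤ Real.exp (-C) ^ F.card := by gcongr
    _ = Real.exp (-(C * F.card)) := by rw [← Real.exp_nat_mul]; ring_nf
    _ ≤ _ := by gcongr

end proposalAlgorithm

/-- For every exponent `κ` of the identifier space there is a bandwidth constant `B` such that, for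
all `ε > 0` and `C > 0`, some algorithm with messages of at most `B log₂ n` bits and
`O(log Δ / log log Δ)` rounds always outputs a matching, and this matching is a
`(2 + ε)`-approximation of a maximum one with probability at least `1 - exp (-C |OPT|)`. -/
theorem mainTheorem2 (κ : ℕ) :
    ∃ B : ℕ, ∀ ε : ℝ, 0 < ε → ∀ C : ℝ, 0 < C →
      ∃ (A : DistributedAlgorithm) (c : ℝ),
        (∀ n Δ : ℕ, Δ ≤ 2 → (A.rounds n Δ : ℝ) ≤ c) ∧
        (∀ n Δ : ℕ, 3 ≤ Δ →
          (A.rounds n Δ : ℝ) ≤ c * (Real.log Δ / Real.log (Real.log Δ))) ∧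
        ∀ (n : ℕ) (N : Network n), (∀ v, N.id v < n ^ κ) →
          (∀ r : A.Seeds N, A.MessagesAtMost N r (B * Nat.log 2 n)) ∧
          (∀ r : A.Seeds N, ∃ M : N.graph.Subgraph, A.ComputesMatching N r M) ∧
          1 - Real.exp (-(C * (matchingNumber N.graph : ℝ))) ≤
            A.prob N (fun r => ∃ M : N.graph.Subgraph, A.ComputesMatching N r M ∧
              (matchingNumber N.graph : ℝ) ≤ (2 + ε) * (M.edgeSet.ncard : ℝ)) := by
  obtain ⟨T, c, hc, hT, hT2, hT3⟩ := exists_goodParameters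
  -- All messages are single bits.
  refine ⟨1, fun ε hε C hC => ?_⟩
  -- The number of stages depends only on `ε` and `C`; the halved target leaves room for the factor
  -- 2 per edge from the union bound.
  obtain ⟨J, hJ⟩ := exists_pow_lt_of_lt_one (half_pos (Real.exp_pos (-C)))
    (Real.rpow_lt_one (by norm_num) (by norm_num) (by positivity) :
      (3 / 4 : ℝ) ^ (ε / (2 + ε)) < 1)
  have hJ' : 2 * (3 / 4 : ℝ) ^ (ε / (2 + ε) * J) ≤ Real.exp (-C) := by
    rw [Real.rpow_mul (by norm_num), Real.rpow_natCast]
    linarith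
  have hrounds : ∀ n Δ : ℕ, ((proposalAlgorithm J T).rounds n Δ : ℝ) = 3 * J * T Δ := by
    intro n Δ
    change ((3 * (J * T Δ) : ℕ) : ℝ) = _
    push_cast
    ring
  refine ⟨proposalAlgorithm J T, 3 * J * c, fun n Δ hΔ => ?_, fun n Δ hΔ => ?_, fun n N _ =>
    ⟨fun r => proposalAlgorithm.messagesAtMost, fun r =>
      ⟨_, proposalAlgorithm.computesMatching N r⟩, ?_⟩⟩
  · rw [hrounds]
    gcongr
    exact hT2 Δ hΔ
  · rw [hrounds, mul_assoc _ c]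
    gcongr
    exact hT3 Δ hΔ
  · obtain ⟨β, lam, hp⟩ := hT N.maxDegree
    exact proposalAlgorithm.prob_approximation N hε hJ' hC hp
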